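/- Let $m\ge 2$ be an integer, let $A,B\in\mathbb{Z}$, and let $p\ge 3$ be a prime. Put $F(x)=x^m+Ax^{m-1}+B$ and $D=m^mB-(-1)^m(m-1)^{m-1}A^m$. A polynomial $f(x)\in\mathbb{Z}[x]$ is called monogenic if $f$ is irreducible over $\mathbb{Q}$ and, for a root $\theta$ of $f$, the ring of integers of $\mathbb{Q}(\theta)$ is equal to $\mathbb{Z}[\theta]$. Suppose that one of the following holds for some $u,t\in\mathbb{Z}$: (1) $m=2$, $A=4pu+p^2+2$, $B=2pt+1$, the integers $B$, $B-1$ and $D$ are squarefree, and $|B|\ge 2$; (2) $m\in\{3,4\}$, $A=4p^2u+1$, $B=2pt+p$, the integers $B$ and $D$ are squarefree, and $|B|\ge 2$; (3) $m\ge 5$, $A=4p^2u+1$, $B=2pt+p$, the integers $B$ and $D$ are squarefree, $|B|\ge 2$, and $F(x)$ is irreducible over $\mathbb{Q}$. Then $F(x^{p^n})$ is monogenic for every integer $n\ge 0$. -/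

import Mathlib

open Polynomial
open scoped IntermediateField

/-- The trinomial `x ^ m + A x ^ (m - 1) + B` with integer coefficients (used for `m ≥ 2`). -/
noncomputable def trinomialF (m : ℕ) (A B : ℤ) : ℤ[X] :=
  X ^ m + C A * X ^ (m - 1) + C B

/-- The integer `m ^ m B - (-1) ^ m (m - 1) ^ (m - 1) A ^ m` (used for `m ≥ 2`). -/
def trinomialD (m : ℕ) (A B : ℤ) : ℤ :=
  (m : ℤ) ^ m * B - (-1) ^ m * ((m : ℤ) - 1) ^ (m - 1) * A ^ m

/-- An integer polynomial is irreducible over the rationals. -/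
def IrreducibleOverRat (f : ℤ[X]) : Prop :=
  Irreducible (f.map (Int.castRingHom ℚ))

/-- An integer polynomial `f` is monogenic if it is irreducible over `ℚ` and, for every complex
root `θ` of `f`, the ring `ℤ[θ]` is the whole ring of integers of the number field `ℚ(θ)`
(the integral closure of `ℤ` in it); `gen ℚ θ` is `θ` regarded as an element of `ℚ(θ)`. -/
def IsMonogenic (f : ℤ[X]) : Prop :=
  IrreducibleOverRat f ∧
    ∀ θ : ℂ, aeval θ f = 0 →
      Algebra.adjoin ℤ {IntermediateField.AdjoinSimple.gen ℚ θ} = integralClosure ℤ ℚ⟮θ⟯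

/-! For `f` monic and irreducible, `ℤ[θ] ≅ ℤ[X]/(f)` is integrally closed once `f ∉ M ^ 2` for every
maximal ideal `M` of `ℤ[X]` (`isMonogenic_of_notMem_sq`). Let `f = F(x^(p^n))` and suppose `f ∈ M ^
2`. If `p ∉ M`, then `f' ∈ M` and a Taylor expansion at the nonzero critical point of `F` put `D` in
`M ^ 2`. If `p ∈ M`, the congruences on `A`, `B` force `X ∈ M` or `X + 1 ∈ M`, and evaluating at `0`
or `-1` puts `B` or `D` in `M ^ 2`. Both contradict `C_notMem_sq_of_squarefree`. Irreducibility of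
`F` is checked modulo 2 when `m ≤ 4`; it passes to `f` by a norm argument, as `±B` is not a `p`-th
power. -/

/-! ### Maximal ideals of `ℤ[X]` and their squares -/

lemma Int.isJacobsonRing : IsJacobsonRing ℤ := by
  refine isJacobsonRing_iff_prime_eq.2 fun P hP => ?_
  by_cases h : P = ⊥
  · subst h
    refine (Ideal.jacobson ⊥).eq_bot_iff.2 fun x hx => ?_
    -- `x * x + 1` is a unit of `ℤ`, hence `±1`, so `x = 0`.
    have := Ideal.mem_jacobson_bot.1 hx x
    rw [Int.isUnit_iff] at this
    change x = 0
    rcases this with h | h <;> nlinarith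
  · have := hP.isMaximal h
    exact Ideal.jacobson_eq_self_of_isMaximal

/-- A maximal ideal of `ℤ[X]` is generated by a prime number and a further polynomial. -/
lemma exists_prime_eq_span_pair (M : Ideal ℤ[X]) [M.IsMaximal] :
    ∃ (q : ℕ) (g : ℤ[X]), q.Prime ∧ M = Ideal.span {C (q : ℤ), g} ∧ ¬ C (q : ℤ) ∣ g := by
  have := Int.isJacobsonRing
  have hmax : (M.comap (C : ℤ →+* ℤ[X])).IsMaximal := isMaximal_comap_C_of_isJacobsonRing M
  obtain ⟨k, hk⟩ := IsPrincipalIdealRing.principal (M.comap (C : ℤ →+* ℤ[X]))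
  change _ = Ideal.span {k} at hk
  have hk0 : k ≠ 0 := by
    rintro rfl
    rw [hk] at hmax
    simp only [Ideal.span_singleton_zero] at hmax
    exact Int.not_isField ((Ring.isField_iff_maximal_bot).2 hmax)
  have hkp : Prime k := (Ideal.span_singleton_prime hk0).1 (hk ▸ hmax.isPrime)
  have hq : k.natAbs.Prime := Int.prime_iff_natAbs_prime.1 hkp
  set q := k.natAbs with hqdef
  have hqk : M.comap (C : ℤ →+* ℤ[X]) = Ideal.span {(q : ℤ)} := by
    rw [hk, hqdef, Int.span_natAbs]
  have : Fact q.Prime := ⟨hq⟩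
  have hqM : C (q : ℤ) ∈ M := by
    have : (q : ℤ) ∈ M.comap (C : ℤ →+* ℤ[X]) := hqk ▸ Ideal.mem_span_singleton_self _
    exact this
  let ψ : ℤ[X] →+* (ZMod q)[X] := mapRingHom (Int.castRingHom (ZMod q))
  have hψ : Function.Surjective ψ := map_surjective _ (ZMod.ringHom_surjective _)
  have hker : ∀ h : ℤ[X], ψ h = 0 ↔ C (q : ℤ) ∣ h := by
    intro h
    rw [C_dvd_iff_dvd_coeff, Polynomial.ext_iff]
    refine forall_congr' fun i => ?_
    simp only [ψ, coe_mapRingHom, coeff_map, coeff_zero, eq_intCast]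
    exact ZMod.intCast_zmod_eq_zero_iff_dvd _ _ 
  obtain ⟨g', hg'⟩ := IsPrincipalIdealRing.principal (M.map ψ)
  change _ = Ideal.span {g'} at hg'
  have hg'mem : g' ∈ M.map ψ := hg' ▸ Ideal.mem_span_singleton_self g'
  obtain ⟨g, hgM, rfl⟩ := (Ideal.mem_map_iff_of_surjective ψ hψ).1 hg'mem
  refine ⟨q, g, hq, le_antisymm ?_ ?_, ?_⟩
  · intro h hh
    have h1 : ψ h ∈ Ideal.span {ψ g} := hg' ▸ Ideal.mem_map_of_mem ψ hh
    obtain ⟨c', hc'⟩ := Ideal.mem_span_singleton'.1 h1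
    obtain ⟨c, rfl⟩ := hψ c'
    have h2 : ψ (h - c * g) = 0 := by rw [map_sub, map_mul, hc', sub_self]
    obtain ⟨d, hd⟩ := (hker _).1 h2
    exact Ideal.mem_span_pair.2 ⟨d, c, by linear_combination -hd⟩
  · rw [Ideal.span_le]
    rintro x (rfl | rfl)
    exacts [hqM, hgM]
  · intro hdvd
    rw [(hker g).2 hdvd, Ideal.span_singleton_zero] at hg'
    have hle : RingHom.ker ψ ≤ M := by
      intro h hh
      obtain ⟨d, rfl⟩ := (hker h).1 hh
      exact M.mul_mem_right _ hqM
    have hM : (M.map ψ).IsMaximal := by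
      refine (Ideal.map_eq_top_or_isMaximal_of_surjective ψ hψ ‹_›).resolve_left fun htop => ?_
      rw [htop] at hg'
      exact top_ne_bot hg'
    rw [hg'] at hM
    exact Polynomial.not_isField _ ((Ring.isField_iff_maximal_bot).2 hM)

lemma exists_eq_of_mem_span_pair_sq {R : Type*} [CommRing R] {a b x : R}
    (hx : x ∈ (Ideal.span {a, b}) ^ 2) :
    ∃ c ∈ Ideal.span {a, b}, ∃ d, x = a * c + b ^ 2 * d := by
  rw [pow_two] at hx
  refine Submodule.mul_induction_on hx ?_ ?_
  · intro y hy z hz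
    obtain ⟨r, s, rfl⟩ := Ideal.mem_span_pair.1 hy
    obtain ⟨r', s', rfl⟩ := Ideal.mem_span_pair.1 hz
    exact ⟨_, Ideal.mem_span_pair.2 ⟨r * r', r * s' + s * r', rfl⟩, s * s', by ring⟩
  · rintro y z ⟨c, hc, d, rfl⟩ ⟨c', hc', d', rfl⟩
    exact ⟨c + c', Ideal.add_mem _ hc hc', d + d', by ring⟩

/-- The square of a maximal ideal of `ℤ[X]` contains no squarefree integer. -/
lemma C_notMem_sq_of_squarefree (M : Ideal ℤ[X]) [hM : M.IsMaximal] {k : ℤ} (hk : Squarefree k) :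
    C k ∉ M ^ 2 := by
  intro hkM
  obtain ⟨q, g, hq, hMeq, hqg⟩ := exists_prime_eq_span_pair M
  have hqM : C (q : ℤ) ∈ M := hMeq ▸ Ideal.subset_span (by simp)
  have hcop : ∀ l : ℤ, C l ∈ M → (q : ℤ) ∣ l := by
    intro l hl
    by_contra hql
    have : IsCoprime (q : ℤ) l := (Nat.prime_iff_prime_int.1 hq).coprime_iff_not_dvd.2 hql
    obtain ⟨a, b, hab⟩ := this
    apply hM.ne_top
    rw [Ideal.eq_top_iff_one]
    have h1 : (1 : ℤ[X]) = C a * C (q : ℤ) + C b * C l := by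
      rw [← C_mul, ← C_mul, ← C_add, hab, C_1]
    rw [h1]
    exact M.add_mem (M.mul_mem_left _ hqM) (M.mul_mem_left _ hl)
  obtain ⟨l, rfl⟩ := hcop k (Ideal.pow_le_self two_ne_zero hkM)
  have hql : ¬ (q : ℤ) ∣ l := by
    rintro ⟨r, rfl⟩
    exact (Nat.prime_iff_prime_int.1 hq).not_isUnit (hk _ ⟨r, by ring⟩)
  rw [hMeq] at hkM
  obtain ⟨c, hc, d, hcd⟩ := exists_eq_of_mem_span_pair_sq hkM
  rw [← hMeq] at hc
  have hpr : Prime (C (q : ℤ)) := prime_C_iff.2 (Nat.prime_iff_prime_int.1 hq)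
  -- From `q l = q c + g ^ 2 d` and `q ∤ g`, the prime `q` divides `d`; cancelling it gives `l ∈ M`,
  -- so `q ∣ l`.
  have hd : C (q : ℤ) ∣ g ^ 2 * d := ⟨C l - c, by rw [C_mul] at hcd; linear_combination -hcd⟩
  obtain ⟨e, rfl⟩ := (hpr.dvd_or_dvd hd).resolve_left fun h => hqg (hpr.dvd_of_dvd_pow h)
  refine hql (hcop l ?_)
  have hl : C l = c + g ^ 2 * e := by
    refine mul_left_cancel₀ hpr.ne_zero ?_
    rw [← C_mul, hcd]; ring
  have hgM : g ∈ M := hMeq ▸ Ideal.subset_span (by simp)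
  rw [hl]
  exact M.add_mem hc (M.mul_mem_right _ (M.pow_mem_of_mem hgM 2 two_pos))

/-- Since `X ≡ c` modulo `M`, the substitution `X ↦ c` maps `M` into itself, hence also `M ^ 2`. -/
lemma C_eval_mem_sq {R : Type*} [CommRing R] (M : Ideal R[X]) {f : R[X]} (hf : f ∈ M ^ 2) {c : R}
    (hc : X - C c ∈ M) : C (f.eval c) ∈ M ^ 2 := by
  rw [pow_two] at hf ⊢
  have hmem : ∀ y ∈ M, C (y.eval c) ∈ M := by
    intro y hy
    obtain ⟨z, hz⟩ := X_sub_C_dvd_sub_C_eval (p := y) (a := c)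
    have : C (y.eval c) = y - (X - C c) * z := by linear_combination -hz
    rw [this]
    exact M.sub_mem hy (M.mul_mem_right _ hc)
  refine Submodule.mul_induction_on hf ?_ ?_
  · intro y hy z hz
    rw [eval_mul, C_mul]
    exact Ideal.mul_mem_mul (hmem y hy) (hmem z hz)
  · intro y z hy hz
    rw [eval_add, C_add]
    exact Ideal.add_mem _ hy hz

lemma derivative_mem_of_mem_sq {R : Type*} [CommRing R] (M : Ideal R[X]) {f : R[X]}
    (hf : f ∈ M ^ 2) : derivative f ∈ M := by
  rw [pow_two] at hf
  refine Submodule.mul_induction_on hf ?_ ?_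
  · intro y hy z hz
    rw [derivative_mul]
    exact M.add_mem (M.mul_mem_left _ hz) (M.mul_mem_right _ hy)
  · intro y z hy hz
    rw [derivative_add]
    exact M.add_mem hy hz

/-! ### The criterion for monogenicity -/

/-- A domain that is a quotient of `ℤ[X]` by a principal ideal `(f)` is integrally closed if `f` is
in the square of no maximal ideal. -/
lemma isIntegrallyClosed_of_notMem_sq {R : Type*} [CommRing R] [IsDomain R] (φ : ℤ[X] →+* R)
    (hφ : Function.Surjective φ) {f : ℤ[X]} (hf : RingHom.ker φ = Ideal.span {f})
    (hsq : ∀ M : Ideal ℤ[X], M.IsMaximal → f ∉ M ^ 2) : IsIntegrallyClosed R := by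
  have : IsNoetherianRing R := isNoetherianRing_of_surjective _ _ φ hφ
  refine IsIntegrallyClosed.of_localization_maximal fun P _ hP => ?_
  set M := P.comap φ with hMdef
  have hM : M.IsMaximal := Ideal.comap_isMaximal_of_surjective φ hφ
  obtain ⟨q, g, hq, hMeq, -⟩ := exists_prime_eq_span_pair M
  have hPeq : P = Ideal.span {φ (C (q : ℤ)), φ g} := by
    rw [← Ideal.map_comap_of_surjective φ hφ P, ← hMdef, hMeq, Ideal.map_span, Set.image_pair]
  have hfφ : φ f = 0 := by
    have : f ∈ RingHom.ker φ := hf ▸ Ideal.mem_span_singleton_self f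
    exact this
  have hfM : f ∈ M := by
    change φ f ∈ P
    rw [hfφ]
    exact P.zero_mem
  have hunit : ∀ x, x ∉ M → IsUnit (algebraMap R (Localization.AtPrime P) (φ x)) := fun x hx =>
    IsLocalization.map_units (Localization.AtPrime P) (⟨φ x, hx⟩ : P.primeCompl)
  -- As `f = s q + t g ∉ M ^ 2`, one of `s`, `t` is a unit at `P`; the relation `f = 0` then makes
  -- one of the two generators redundant.
  obtain ⟨s, t, hst⟩ := Ideal.mem_span_pair.1 (hMeq ▸ hfM)
  have hrel : algebraMap R (Localization.AtPrime P) (φ s) * algebraMap R _ (φ (C (q : ℤ))) +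
      algebraMap R _ (φ t) * algebraMap R _ (φ g) = 0 := by
    rw [← map_mul, ← map_mul, ← map_mul, ← map_mul, ← map_add, ← map_add, hst, hfφ, map_zero]
  have hmax : IsLocalRing.maximalIdeal (Localization.AtPrime P) =
      Ideal.span {algebraMap R _ (φ (C (q : ℤ))), algebraMap R _ (φ g)} := by
    rw [← Localization.AtPrime.map_eq_maximalIdeal, ← Set.image_pair, ← Ideal.map_span]
    exact congrArg _ hPeq
  have key : ∀ {S : Type _} [CommRing S] {a b u v : S}, IsUnit u → u * a + v * b = 0 →
      Ideal.span {a, b} = Ideal.span {b} := by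
    intro S _ a b u v hu h
    refine le_antisymm ?_ (Ideal.span_mono (by simp))
    rw [Ideal.span_le]
    rintro x (rfl | rfl)
    · obtain ⟨u, rfl⟩ := hu
      refine Ideal.mem_span_singleton'.2 ⟨-(↑u⁻¹ * v), ?_⟩
      have := u.inv_mul
      linear_combination (-(↑u⁻¹ : S)) * h + x * this
    · exact Ideal.mem_span_singleton_self _
  have hprin : (IsLocalRing.maximalIdeal (Localization.AtPrime P)).IsPrincipal := by
    by_cases hs : s ∈ M
    · by_cases ht : t ∈ M
      · refine absurd ?_ (hsq M hM)
        rw [← hst, pow_two]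
        exact Ideal.add_mem _
          (Ideal.mul_mem_mul hs (by rw [hMeq]; exact Ideal.subset_span (by simp)))
          (Ideal.mul_mem_mul ht (by rw [hMeq]; exact Ideal.subset_span (by simp)))
      · rw [hmax, Set.pair_comm, key (hunit t ht) (by rw [add_comm]; exact hrel)]
        exact ⟨_, rfl⟩
    · rw [hmax, key (hunit s hs) hrel]
      exact ⟨_, rfl⟩
  have := ((tfae_of_isNoetherianRing_of_isLocalRing_of_isDomain
    (Localization.AtPrime P)).out 4 3).1 hprin
  exact this.1

/-- A monic irreducible integer polynomial lying in the square of no maximal ideal of `ℤ[X]` is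
monogenic. -/
lemma isMonogenic_of_notMem_sq {f : ℤ[X]} (hmonic : f.Monic) (hirr : IrreducibleOverRat f)
    (hsq : ∀ M : Ideal ℤ[X], M.IsMaximal → f ∈ M → f ∉ M ^ 2) : IsMonogenic f := by
  refine ⟨hirr, fun θ hθ => ?_⟩
  set γ := IntermediateField.AdjoinSimple.gen ℚ θ with hγ
  have hfγ : aeval γ f = 0 := by
    apply (algebraMap ℚ⟮θ⟯ ℂ).injective
    rw [← aeval_algebraMap_apply, IntermediateField.AdjoinSimple.algebraMap_gen, hθ, map_zero]
  have hint : IsIntegral ℤ γ := ⟨f, hmonic, hfγ⟩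
  have hθint : IsIntegral ℚ θ := IsIntegral.tower_top (R := ℤ) ⟨f, hmonic, hθ⟩
  have hmin : f = minpoly ℤ γ := by
    refine map_injective (algebraMap ℤ ℚ) (Int.cast_injective) ?_
    rw [← minpoly.isIntegrallyClosed_eq_field_fractions' ℚ hint]
    refine minpoly.eq_of_irreducible_of_monic hirr ?_ (hmonic.map _)
    rw [aeval_map_algebraMap, hfγ]
  have hadj := Algebra.adjoin_singleton_eq_range_aeval ℤ γ
  let φ : ℤ[X] →+* Algebra.adjoin ℤ {γ} :=
    (aeval (⟨γ, Algebra.self_mem_adjoin_singleton ℤ γ⟩ : Algebra.adjoin ℤ {γ})).toRingHom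
  have hφ : ∀ h, (φ h : ℚ⟮θ⟯) = aeval γ h := fun h =>
    (aeval_algebraMap_apply ℚ⟮θ⟯ (⟨γ, Algebra.self_mem_adjoin_singleton ℤ γ⟩ :
      Algebra.adjoin ℤ {γ}) h).symm
  have hsurj : Function.Surjective φ := by
    rintro ⟨x, hx⟩
    obtain ⟨h, rfl⟩ := (hadj ▸ hx : x ∈ (aeval γ : ℤ[X] →ₐ[ℤ] _).range)
    exact ⟨h, Subtype.ext (hφ h)⟩
  have hker : RingHom.ker φ = Ideal.span {f} := by
    ext h
    rw [RingHom.mem_ker, Ideal.mem_span_singleton, hmin, ← minpoly.isIntegrallyClosed_dvd_iff hint,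
      ← hφ, ZeroMemClass.coe_eq_zero]
  have := isIntegrallyClosed_of_notMem_sq φ hsurj hker
    fun M hM h => hsq M hM (Ideal.pow_le_self two_ne_zero h) h
  have hfrac : IsFractionRing (Algebra.adjoin ℤ {γ}) ℚ⟮θ⟯ := by
    refine IsFractionRing.of_field _ _ fun z => ?_
    obtain ⟨h, hh⟩ : ∃ h : ℚ[X], aeval γ h = z := by
      have hz := z.2
      rw [← IntermediateField.mem_toSubalgebra,
        IntermediateField.adjoin_simple_toSubalgebra_of_isAlgebraic hθint.isAlgebraic,
        Algebra.adjoin_singleton_eq_range_aeval] at hz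
      obtain ⟨h, hh⟩ := hz
      refine ⟨h, (algebraMap ℚ⟮θ⟯ ℂ).injective ?_⟩
      rw [← aeval_algebraMap_apply, IntermediateField.AdjoinSimple.algebraMap_gen]
      exact hh
    obtain ⟨b, hb, hbh⟩ := IsLocalization.integerNormalization_spec (nonZeroDivisors ℤ) h
    have hb0 : (b : ℚ⟮θ⟯) ≠ 0 := Int.cast_ne_zero.2 (nonZeroDivisors.ne_zero hb)
    refine ⟨φ (IsLocalization.integerNormalization (nonZeroDivisors ℤ) h), b, ?_⟩
    change z = (φ _ : ℚ⟮θ⟯) / _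
    rw [hφ, ← aeval_map_algebraMap ℚ, hbh, map_zsmul, hh, map_intCast, zsmul_eq_mul]
    field_simp
  apply le_antisymm
  · rw [Algebra.adjoin_le_iff, Set.singleton_subset_iff]
    exact hint
  · intro x hx
    have hx' : IsIntegral (Algebra.adjoin ℤ {γ}) x := IsIntegral.tower_top (R := ℤ) hx
    obtain ⟨y, rfl⟩ := (isIntegrallyClosed_iff ℚ⟮θ⟯).1 ‹_› hx'
    exact y.2

/-! ### Irreducibility of `F(x^(p^n))` -/

/-- For a root `x` of `F`, it suffices that `X^(p^n) - x` is irreducible over `K(x)`; for odd `p`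
this only needs `x` not to be a `p`-th power there, which the norm of `x` detects. -/
lemma irreducible_comp_X_pow_of_coeff_zero {K : Type*} [Field K] {F : K[X]} (hF : F.Monic)
    (hirr : Irreducible F) {p : ℕ} (hp : p.Prime) (hp2 : p ≠ 2)
    (hc : ∀ c : K, c ^ p ≠ (-1) ^ F.natDegree * F.coeff 0) (n : ℕ) :
    Irreducible (F.comp (X ^ p ^ n)) := by
  refine irreducible_comp hF (monic_X_pow _) hirr fun E _ _ x hx => ?_
  rw [Polynomial.map_pow, map_X]
  refine X_pow_sub_C_irreducible_of_prime_pow hp hp2 n fun b hb => hc (Algebra.norm K b) ?_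
  have hint : IsIntegral K x := by
    by_contra h
    rw [minpoly.eq_zero h] at hx
    exact hF.ne_zero hx.symm
  rw [← map_pow, hb, ← IntermediateField.adjoin.powerBasis_gen hint,
    Algebra.PowerBasis.norm_gen_eq_coeff_zero_minpoly, IntermediateField.adjoin.powerBasis_gen,
    IntermediateField.minpoly_gen, hx, IntermediateField.adjoin.powerBasis_dim, hx]

lemma irreducible_comp_X_pow_prime_pow {F : ℤ[X]} (hF : F.Monic) (hirr : IrreducibleOverRat F)
    {p : ℕ} (hp : p.Prime) (hp2 : p ≠ 2) (hsf : Squarefree (F.coeff 0)) (habs : 2 ≤ |F.coeff 0|)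
    (n : ℕ) : IrreducibleOverRat (F.comp (X ^ p ^ n)) := by
  unfold IrreducibleOverRat at hirr ⊢
  rw [map_comp, Polynomial.map_pow, map_X]
  refine irreducible_comp_X_pow_of_coeff_zero (hF.map _) hirr hp hp2 (fun c hc => ?_) n
  rw [coeff_map, eq_intCast] at hc
  obtain ⟨c, rfl⟩ : ∃ c' : ℤ, (c' : ℚ) = c := by
    refine (IsIntegrallyClosed.isIntegral_iff (R := ℤ)).1 (IsIntegral.of_pow hp.pos ?_)
    rw [hc]
    exact (isIntegral_one.neg.pow _).mul (isIntegral_algebraMap (R := ℤ))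
  have hc' : c ^ p = (-1) ^ (F.map (Int.castRingHom ℚ)).natDegree * F.coeff 0 := by
    exact_mod_cast hc
  -- `c ^ 2 ∣ c ^ p = ±B` with `B` squarefree; then `|B| = 1`, against `habs`.
  have hu : IsUnit c := by
    refine hsf _ ?_
    rw [← ((isUnit_one.neg.pow (F.map (Int.castRingHom ℚ)).natDegree).dvd_mul_left), ← hc',
      ← pow_two]
    exact pow_dvd_pow _ hp.two_le
  have h1 := congrArg abs hc'
  rw [abs_mul, abs_pow, abs_pow, Int.isUnit_iff_abs_eq.1 hu, abs_neg, abs_one, one_pow, one_pow,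
    one_mul] at h1
  omega

/-! ### The trinomial and the squares of maximal ideals -/

lemma trinomialF_monic (k : ℕ) (A B : ℤ) : (trinomialF (k + 2) A B).Monic := by
  unfold trinomialF
  rw [show k + 2 - 1 = k + 1 from rfl, add_assoc]
  refine monic_X_pow_add (lt_of_le_of_lt (b := ((k + 1 : ℕ) : WithBot ℕ)) ?_ ?_)
  · compute_degree
    norm_cast
  · exact_mod_cast Nat.lt_succ_self _

lemma trinomialF_coeff_zero (k : ℕ) (A B : ℤ) : (trinomialF (k + 2) A B).coeff 0 = B := by
  simp [trinomialF, coeff_X_pow]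

lemma derivative_trinomialF (k : ℕ) (A B : ℤ) :
    derivative (trinomialF (k + 2) A B) =
      X ^ k * (C ((k : ℤ) + 2) * X + C (((k : ℤ) + 1) * A)) := by
  simp [trinomialF]
  ring

/-- Up to the constant `trinomialD`, a multiple of `trinomialF` is divisible by the square of the
nonmonomial factor of its derivative. -/
lemma exists_trinomialF_eq (k : ℕ) (A B : ℤ) :
    ∃ H : ℤ[X], C (((k : ℤ) + 2) ^ (k + 2)) * trinomialF (k + 2) A B =
      (C ((k : ℤ) + 2) * X + C (((k : ℤ) + 1) * A)) ^ 2 * H + C (trinomialD (k + 2) A B) := by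
  -- With `m = k + 2` and `Y = mX`, `m^m F = Y^m + mA Y^(m-1) + m^m B`. The expansion is at the
  -- critical point `Y = -(m-1)A`, so the linear term vanishes.
  obtain ⟨H, hH⟩ := binomExpansion
    (X ^ (k + 2) + C (C (((k : ℤ) + 2) * A)) * X ^ (k + 1) : ℤ[X][X])
    (-C (((k : ℤ) + 1) * A)) (C ((k : ℤ) + 2) * X + C (((k : ℤ) + 1) * A))
  refine ⟨H, ?_⟩
  rw [neg_add_cancel_comm_assoc] at hH
  simp only [trinomialF, trinomialD, eval_add, eval_mul, eval_pow, eval_X, eval_C, derivative_add,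
    derivative_mul, derivative_C, derivative_X_pow, Nat.add_one_sub_one] at hH ⊢
  simp at hH ⊢
  rw [show (k : ℤ[X]) + 2 - 1 = k + 1 by ring]
  simp only [neg_pow (((k : ℤ[X]) + 1) * A), mul_pow] at hH
  linear_combination hH

lemma comp_X_pow_notMem_sq {k : ℕ} {A B : ℤ} (hB : Squarefree B)
    (hD : Squarefree (trinomialD (k + 2) A B)) {N : ℕ} (hN : N ≠ 0) (M : Ideal ℤ[X])
    [hM : M.IsMaximal] (hNM : C (N : ℤ) ∉ M) : (trinomialF (k + 2) A B).comp (X ^ N) ∉ M ^ 2 := by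
  intro hf
  have hX : X ∉ M := fun h => by
    have := C_eval_mem_sq M hf (c := 0) (by simpa using h)
    rw [eval_comp, eval_pow, eval_X, zero_pow hN, ← coeff_zero_eq_eval_zero,
      trinomialF_coeff_zero] at this
    exact C_notMem_sq_of_squarefree M hB this
  have hd := derivative_mem_of_mem_sq M hf
  rw [derivative_comp, derivative_trinomialF, derivative_X_pow, mul_comp, X_pow_comp] at hd
  have hw : (C ((k : ℤ) + 2) * X + C (((k : ℤ) + 1) * A)).comp (X ^ N) ∈ M := by
    have hprime := hM.isPrime
    rcases hprime.mem_or_mem hd with h | h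
    · rcases hprime.mem_or_mem h with h | h
      · exact absurd h (by simpa using hNM)
      · exact absurd (hprime.mem_of_pow_mem _ h) hX
    · rcases hprime.mem_or_mem h with h | h
      · exact absurd (hprime.mem_of_pow_mem _ (hprime.mem_of_pow_mem _ h)) hX
      · exact h
  obtain ⟨H, hH⟩ := exists_trinomialF_eq k A B
  have hH' := congrArg (fun g => g.comp (X ^ N)) hH
  simp only [mul_comp, add_comp, pow_comp, C_comp] at hH'
  refine C_notMem_sq_of_squarefree M hD ?_
  rw [← sub_eq_of_eq_add' hH']
  refine Ideal.sub_mem _ (Ideal.mul_mem_left _ _ hf) (Ideal.mul_mem_right _ _ ?_)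
  have := Ideal.pow_mem_pow hw 2
  simpa only [mul_comp, add_comp, pow_comp, C_comp] using this

/-- Frobenius: `X^(p^n) + 1 ≡ (X + 1)^(p^n)` modulo `p`. -/
lemma X_sub_C_neg_one_mem {p n : ℕ} (hp : p.Prime) (M : Ideal ℤ[X]) [hM : M.IsPrime]
    (hpM : C (p : ℤ) ∈ M) (h : X ^ p ^ n + 1 ∈ M) : X - C (-1 : ℤ) ∈ M := by
  obtain ⟨r, hr⟩ := exists_add_pow_prime_pow_eq hp (X : ℤ[X]) 1 n
  rw [one_pow] at hr
  have : (X + 1 : ℤ[X]) ∈ M := by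
    refine hM.mem_of_pow_mem (p ^ n) ?_
    rw [hr]
    refine M.add_mem h ?_
    rw [mul_assoc, mul_assoc]
    exact M.mul_mem_right _ (by simpa using hpM)
  simpa using this

lemma C_mem_of_dvd {M : Ideal ℤ[X]} {a b : ℤ} (h : C a ∈ M) (hab : a ∣ b) : C b ∈ M :=
  M.mem_of_dvd (map_dvd C hab) h

lemma eval_comp_X_pow_neg_one {N : ℕ} (hN : Odd N) (F : ℤ[X]) :
    (F.comp (X ^ N)).eval (-1) = F.eval (-1) := by
  rw [eval_comp, eval_pow, eval_X, hN.neg_one_pow]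

/-- Modulo `p`, `F = x^(m-1) (x + 1)`. Moreover `F(0) = B`, and `F(-1) ≡ B` modulo `p ^ 2`. -/
lemma comp_X_pow_notMem_sq_of_dvd {k : ℕ} {A B : ℤ} (hB : Squarefree B) {p : ℕ} (hp : p.Prime)
    (hp2 : p ≠ 2) (hpA : (p : ℤ) ^ 2 ∣ A - 1) (hpB : (p : ℤ) ∣ B) (n : ℕ) (M : Ideal ℤ[X])
    [hM : M.IsMaximal] (hpM : C (p : ℤ) ∈ M) :
    (trinomialF (k + 2) A B).comp (X ^ p ^ n) ∉ M ^ 2 := by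
  intro hf
  have hprime := hM.isPrime
  have hN : p ^ n ≠ 0 := pow_ne_zero _ hp.ne_zero
  have hfM := Ideal.pow_le_self two_ne_zero hf
  have hA1 : C (A - 1) ∈ M := C_mem_of_dvd hpM ((dvd_pow_self _ two_ne_zero).trans hpA)
  have hprod : (X ^ p ^ n) ^ (k + 1) * (X ^ p ^ n + 1 : ℤ[X]) ∈ M := by
    have : (X ^ p ^ n) ^ (k + 1) * (X ^ p ^ n + 1 : ℤ[X]) =
        (trinomialF (k + 2) A B).comp (X ^ p ^ n) - C (A - 1) * (X ^ p ^ n) ^ (k + 1) - C B := by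
      simp [trinomialF]
      ring
    rw [this]
    exact M.sub_mem (M.sub_mem hfM (M.mul_mem_right _ hA1)) (C_mem_of_dvd hpM hpB)
  rcases hprime.mem_or_mem hprod with h | h
  · have hX := hprime.mem_of_pow_mem _ (hprime.mem_of_pow_mem _ h)
    have := C_eval_mem_sq M hf (c := 0) (by simpa using hX)
    rw [eval_comp, eval_pow, eval_X, zero_pow hN, ← coeff_zero_eq_eval_zero,
      trinomialF_coeff_zero] at this
    exact C_notMem_sq_of_squarefree M hB this
  · have := C_eval_mem_sq M hf (X_sub_C_neg_one_mem hp M hpM h)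
    rw [eval_comp_X_pow_neg_one (hp.odd_of_ne_two hp2).pow] at this
    refine C_notMem_sq_of_squarefree M hB ?_
    have hpM2 : C ((p : ℤ) ^ 2) ∈ M ^ 2 := by
      rw [C_pow]
      exact Ideal.pow_mem_pow hpM 2
    have hBeq : C B = C ((trinomialF (k + 2) A B).eval (-1)) - C ((A - 1) * (-1) ^ (k + 1)) := by
      rw [← C_sub]
      congr 1
      simp [trinomialF]
      ring
    rw [hBeq]
    exact Ideal.sub_mem _ this (C_mem_of_dvd hpM2 (hpA.mul_right _))

/-- Modulo `p`, `F = (x + 1)^2`, and `D = 4 F(-1) - (A - 2)^2`. -/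
lemma quadratic_comp_X_pow_notMem_sq {A B : ℤ} (hD : Squarefree (trinomialD 2 A B)) {p : ℕ}
    (hp : p.Prime) (hp2 : p ≠ 2) (hpA : (p : ℤ) ∣ A - 2) (hpB : (p : ℤ) ∣ B - 1) (n : ℕ)
    (M : Ideal ℤ[X]) [hM : M.IsMaximal] (hpM : C (p : ℤ) ∈ M) :
    (trinomialF 2 A B).comp (X ^ p ^ n) ∉ M ^ 2 := by
  intro hf
  have hprime := hM.isPrime
  have hfM := Ideal.pow_le_self two_ne_zero hf
  have hsq : (X ^ p ^ n + 1 : ℤ[X]) ^ 2 ∈ M := by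
    have : (X ^ p ^ n + 1 : ℤ[X]) ^ 2 =
        (trinomialF 2 A B).comp (X ^ p ^ n) - C (A - 2) * X ^ p ^ n - C (B - 1) := by
      simp [trinomialF]
      ring
    rw [this]
    exact M.sub_mem (M.sub_mem hfM (M.mul_mem_right _ (C_mem_of_dvd hpM hpA)))
      (C_mem_of_dvd hpM hpB)
  have := C_eval_mem_sq M hf (X_sub_C_neg_one_mem hp M hpM (hprime.mem_of_pow_mem _ hsq))
  rw [eval_comp_X_pow_neg_one (hp.odd_of_ne_two hp2).pow] at this
  refine C_notMem_sq_of_squarefree M hD ?_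
  have hpM2 : C ((p : ℤ) ^ 2) ∈ M ^ 2 := by
    rw [C_pow]
    exact Ideal.pow_mem_pow hpM 2
  have hDeq : C (trinomialD 2 A B) = C 4 * C ((trinomialF 2 A B).eval (-1)) - C ((A - 2) ^ 2) := by
    rw [← C_mul, ← C_sub]
    congr 1
    simp [trinomialF, trinomialD]
    ring
  rw [hDeq]
  exact Ideal.sub_mem _ (Ideal.mul_mem_left _ _ this) (C_mem_of_dvd hpM2 (pow_dvd_pow_of_dvd hpA 2))

/-! ### Irreducibility of `F` by reduction modulo 2 -/

lemma irreducibleOverRat_of_irreducible_map {F : ℤ[X]} (hF : F.Monic) {q : ℕ} [Fact q.Prime]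
    (h : Irreducible (F.map (Int.castRingHom (ZMod q)))) : IrreducibleOverRat F :=
  (hF.irreducible_iff_irreducible_map_fraction_map (K := ℚ)).1
    (hF.irreducible_of_irreducible_map (Int.castRingHom (ZMod q)) F h)

lemma trinomialF_map_two {k : ℕ} {A B : ℤ} (hA : Odd A) (hB : Odd B) :
    (trinomialF (k + 2) A B).map (Int.castRingHom (ZMod 2)) = X ^ (k + 2) + X ^ (k + 1) + 1 := by
  have hA' : (A : ZMod 2) = 1 := by
    rwa [ZMod.intCast_eq_one_iff_odd]
  have hB' : (B : ZMod 2) = 1 := by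
    rwa [ZMod.intCast_eq_one_iff_odd]
  simp only [trinomialF, Polynomial.map_add, Polynomial.map_mul, Polynomial.map_pow, map_X, map_C,
    Nat.add_one_sub_one]
  rw [eq_intCast, eq_intCast, hA', hB', C_1, one_mul]

/-- The bound is sharp: `x^5 + x^4 + 1 = (x^2 + x + 1)(x^3 + x + 1)` over `ZMod 2`. -/
lemma irreducible_trinomial_zmod_two {k : ℕ} (hk : k ≤ 2) :
    Irreducible (X ^ (k + 2) + X ^ (k + 1) + 1 : (ZMod 2)[X]) := by
  have hroot : ∀ (k : ℕ) (x : ZMod 2), ¬ IsRoot (X ^ (k + 2) + X ^ (k + 1) + 1 : (ZMod 2)[X]) x := by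
    intro k x
    obtain rfl | rfl : x = 0 ∨ x = 1 := by revert x; decide
    · simp [IsRoot.def]
    · simp [IsRoot.def, CharTwo.add_self_eq_zero]
  have hdeg : (X ^ (k + 2) + X ^ (k + 1) + 1 : (ZMod 2)[X]).natDegree = k + 2 := by
    compute_degree!
  rcases Nat.lt_or_ge k 2 with hk' | hk'
  · exact irreducible_of_degree_le_three_of_not_isRoot (by rw [hdeg, Finset.mem_Icc]; omega)
      (hroot k)
  · obtain rfl : k = 2 := le_antisymm hk hk'
    have hmon : (X ^ (2 + 2) + X ^ (2 + 1) + 1 : (ZMod 2)[X]).Monic := by monicity!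
    have hne : (X ^ (2 + 2) + X ^ (2 + 1) + 1 : (ZMod 2)[X]) ≠ 1 := by
      intro h
      rw [h] at hdeg
      simp at hdeg
    rw [hmon.irreducible_iff_lt_natDegree_lt hne]
    intro g hg hgdeg hdvd
    rw [hdeg, Finset.mem_Ioc] at hgdeg
    obtain h1 | h2 : g.natDegree = 1 ∨ g.natDegree = 2 := by omega
    · rw [hg.eq_X_add_C h1] at hdvd
      refine hroot 2 (-g.coeff 0) (dvd_iff_isRoot.1 ?_)
      simpa only [C_neg, sub_neg_eq_add] using hdvd
    -- A product of two monic quadratics is excluded by comparing coefficients over all choices in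
    -- `ZMod 2`.
    · obtain ⟨h, hh⟩ := hdvd
      have hhm : h.Monic := hg.of_mul_monic_left (hh ▸ hmon)
      have hhdeg : h.natDegree = 2 := by
        have := congrArg natDegree hh
        rw [hdeg, hg.natDegree_mul hhm] at this
        omega
      have hge := hg.as_sum
      have hhe := hhm.as_sum
      rw [h2] at hge
      rw [hhdeg] at hhe
      simp only [Finset.sum_range_succ, Finset.sum_range_zero, zero_add, pow_zero, pow_one,
        mul_one] at hge hhe
      rw [hge, hhe] at hh
      generalize g.coeff 0 = a at *
      generalize g.coeff 1 = b at *
      generalize h.coeff 0 = c at *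
      generalize h.coeff 1 = d at *
      have e : (X ^ 2 + (C a + C b * X)) * (X ^ 2 + (C c + C d * X)) =
          X ^ 4 + C (b + d) * X ^ 3 + C (a + c + b * d) * X ^ 2 + C (a * d + b * c) * X +
            C (a * c) := by
        simp only [C_add, C_mul]
        ring
      rw [e] at hh
      have h0 := congrArg (fun r => coeff r 0) hh
      have h1 := congrArg (fun r => coeff r 1) hh
      have h2 := congrArg (fun r => coeff r 2) hh
      have h3 := congrArg (fun r => coeff r 3) hh
      simp only [coeff_add, coeff_C_mul, coeff_X_pow, coeff_X, coeff_one, coeff_C] at h0 h1 h2 h3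
      norm_num at h0 h1 h2 h3
      clear hge hhe hh e
      revert a b c d
      decide

/-! ### Conclusion -/

/-- If `B` and `trinomialD` are squarefree, then `F(x ^ (p ^ n))` is monogenic as soon as `F` is
irreducible and the condition at the prime `p` holds. -/
lemma isMonogenic_comp_X_pow {k : ℕ} {A B : ℤ} (hirr : IrreducibleOverRat (trinomialF (k + 2) A B))
    (hB : Squarefree B) (hD : Squarefree (trinomialD (k + 2) A B)) (habs : 2 ≤ |B|) {p : ℕ}
    (hp : p.Prime) (hp2 : p ≠ 2) (n : ℕ)
    (hpM : ∀ M : Ideal ℤ[X], M.IsMaximal → C (p : ℤ) ∈ M →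
      (trinomialF (k + 2) A B).comp (X ^ p ^ n) ∉ M ^ 2) :
    IsMonogenic ((trinomialF (k + 2) A B).comp (X ^ p ^ n)) := by
  have hN : p ^ n ≠ 0 := pow_ne_zero _ hp.ne_zero
  refine isMonogenic_of_notMem_sq ?_ ?_ fun M hM _ => ?_
  · exact (trinomialF_monic k A B).comp (monic_X_pow _) (by simpa using hN)
  · exact irreducible_comp_X_pow_prime_pow (trinomialF_monic k A B) hirr hp hp2
      (by rwa [trinomialF_coeff_zero]) (by rwa [trinomialF_coeff_zero]) n
  · by_cases h : C (p : ℤ) ∈ M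
    · exact hpM M hM h
    · refine comp_X_pow_notMem_sq hB hD hN M fun h' => h ?_
      refine hM.isPrime.mem_of_pow_mem n ?_
      rwa [← C_pow, ← Nat.cast_pow]

lemma irreducibleOverRat_trinomialF_of_odd {k : ℕ} (hk : k ≤ 2) {A B : ℤ} (hA : Odd A)
    (hB : Odd B) : IrreducibleOverRat (trinomialF (k + 2) A B) :=
  irreducibleOverRat_of_irreducible_map (q := 2) (trinomialF_monic k A B)
    (by rw [trinomialF_map_two hA hB]; exact irreducible_trinomial_zmod_two hk)

theorem theorem1p1 (p : ℕ) (hp : p.Prime) (hp3 : 3 ≤ p) (m : ℕ) (A B u t : ℤ)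
    (hcases :
      (m = 2 ∧ A = 4 * p * u + p ^ 2 + 2 ∧ B = 2 * p * t + 1 ∧
        Squarefree B ∧ Squarefree (B - 1) ∧ Squarefree (trinomialD m A B) ∧ 2 ≤ |B|) ∨
      ((m = 3 ∨ m = 4) ∧ A = 4 * p ^ 2 * u + 1 ∧ B = 2 * p * t + p ∧
        Squarefree B ∧ Squarefree (trinomialD m A B) ∧ 2 ≤ |B|) ∨
      (5 ≤ m ∧ A = 4 * p ^ 2 * u + 1 ∧ B = 2 * p * t + p ∧
        Squarefree B ∧ Squarefree (trinomialD m A B) ∧ 2 ≤ |B| ∧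
        IrreducibleOverRat (trinomialF m A B))) :
    ∀ n : ℕ, IsMonogenic ((trinomialF m A B).comp (X ^ p ^ n)) := by
  intro n
  have hp2 : p ≠ 2 := by omega
  have hpodd : Odd (p : ℤ) := by exact_mod_cast hp.odd_of_ne_two hp2
  rcases hcases with ⟨rfl, hA, hB, hBsf, -, hD, habs⟩ | h
  · have hAodd : Odd A := by
      rw [hA, show 4 * p * u + (p : ℤ) ^ 2 + 2 = (p : ℤ) ^ 2 + 2 * (2 * p * u + 1) by ring]
      exact hpodd.pow.add_even (even_two_mul _)
    have hBodd : Odd B := ⟨p * t, by rw [hB]; ring⟩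
    refine isMonogenic_comp_X_pow (k := 0)
      (irreducibleOverRat_trinomialF_of_odd (by omega) hAodd hBodd) hBsf hD habs hp hp2 n
      fun M hM hpM => ?_
    exact quadratic_comp_X_pow_notMem_sq hD hp hp2 ⟨4 * u + p, by rw [hA]; ring⟩
      ⟨2 * t, by rw [hB]; ring⟩ n M hpM
  · obtain ⟨k, rfl, hA, hB, hBsf, hD, habs, hirr⟩ : ∃ k, m = k + 2 ∧ A = 4 * p ^ 2 * u + 1 ∧
        B = 2 * p * t + p ∧ Squarefree B ∧ Squarefree (trinomialD m A B) ∧ 2 ≤ |B| ∧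
        IrreducibleOverRat (trinomialF m A B) := by
      rcases h with ⟨hm, hA, hB, hBsf, hD, habs⟩ | ⟨hm, h⟩
      · obtain ⟨k, rfl⟩ : ∃ k, m = k + 2 := ⟨m - 2, by omega⟩
        refine ⟨k, rfl, hA, hB, hBsf, hD, habs,
          irreducibleOverRat_trinomialF_of_odd (by omega) ⟨2 * p ^ 2 * u, by rw [hA]; ring⟩ ?_⟩
        rw [hB, mul_assoc]
        exact (even_two_mul _).add_odd hpodd
      · exact ⟨m - 2, by omega, h⟩
    refine isMonogenic_comp_X_pow hirr hBsf hD habs hp hp2 n fun M hM hpM => ?_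
    exact comp_X_pow_notMem_sq_of_dvd hBsf hp hp2 ⟨4 * u, by rw [hA]; ring⟩
      ⟨2 * t + 1, by rw [hB]; ring⟩ n M hpM
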